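/- Let $k \ge 1$ and let $f=(f_1,\dots,f_k) : \mathbb{C}^k \to \mathbb{C}^k$ be a polynomial mapping of algebraic degree $d = \max_i \deg f_i \ge 2$. Assume that the topological degree of $f$ equals $d^k$, i.e. that there is a non-zero polynomial $Q$ on $\mathbb{C}^k$ such that every point $p \in \mathbb{C}^k$ with $Q(p) \ne 0$ has exactly $d^k$ distinct preimages under $f$. Then $f$ does not admit a global time average: there are no constant $c \in \mathbb{C}^k$ and no sequence $(a_n)_{n \ge 0}$ of complex numbers, not identically zero, such that the maps $F_N = \sum_{n=0}^{N} a_n f^n$ (where $f^n$ is the $n$-th iterate of $f$ and $f^0 = \mathrm{Id}$) converge to the constant map $c$, uniformly on every compact subset of $\mathbb{C}^k$, as $N \to \infty$. -/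

import Mathlib

/-- The polynomial mapping `ℂ^k → ℂ^k` whose coordinate functions are the polynomials `P i`. -/
noncomputable def polyMap {k : ℕ} (P : Fin k → MvPolynomial (Fin k) ℂ) :
    (Fin k → ℂ) → (Fin k → ℂ) :=
  fun z i => MvPolynomial.eval z (P i)

/-- The algebraic degree of a polynomial mapping: the maximum of the total degrees of its
coordinate functions. -/
def algebraicDegree {k : ℕ} (P : Fin k → MvPolynomial (Fin k) ℂ) : ℕ :=
  Finset.univ.sup fun i => (P i).totalDegree

/-- `f` has topological degree `m`: a generic point, that is, every point outside the zero set
of some non-zero polynomial `Q`, has exactly `m` preimages under `f`. -/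
def HasTopologicalDegree {k : ℕ} (f : (Fin k → ℂ) → (Fin k → ℂ)) (m : ℕ) : Prop :=
  ∃ Q : MvPolynomial (Fin k) ℂ, Q ≠ 0 ∧
    ∀ p : Fin k → ℂ, MvPolynomial.eval p Q ≠ 0 → (f ⁻¹' {p}).encard = m

/-- The topological degree is unique. -/
theorem HasTopologicalDegree.unique {k : ℕ} {f : (Fin k → ℂ) → (Fin k → ℂ)} {m m' : ℕ}
    (h : HasTopologicalDegree f m) (h' : HasTopologicalDegree f m') : m = m' := by
  obtain ⟨Q, hQ, hm⟩ := h
  obtain ⟨Q', hQ', hm'⟩ := h'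
  obtain ⟨p, hp⟩ : ∃ p : Fin k → ℂ, MvPolynomial.eval p (Q * Q') ≠ 0 := by
    by_contra! hc
    exact mul_ne_zero hQ hQ' (MvPolynomial.funext fun x => by rw [hc x, map_zero])
  rw [map_mul] at hp
  have h1 := (hm p (left_ne_zero_of_mul hp)).symm.trans (hm' p (right_ne_zero_of_mul hp))
  exact_mod_cast h1

/-- `f` has a global (weighted) time average: for some weights `a`, not all zero, and some
constant `c`, the sums `∑_{n ≤ N} a n • f^n` of iterates of `f` converge to `c`, uniformly on
every compact subset of `ℂ^k`. -/
def HasGlobalTimeAverage {k : ℕ} (f : (Fin k → ℂ) → (Fin k → ℂ)) : Prop :=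
  ∃ (c : Fin k → ℂ) (a : ℕ → ℂ), (∃ n, a n ≠ 0) ∧
    ∀ K : Set (Fin k → ℂ), IsCompact K →
      TendstoUniformlyOn (fun (N : ℕ) z => ∑ n ∈ Finset.range (N + 1), a n • f^[n] z)
        (fun _ => c) Filter.atTop K

/-! Let `a m` be the first non-zero weight. If `f` identifies two points of the range of `f^[m]`,
all later terms of the two sums agree, so convergence to a common constant makes the points equal:
`f` is injective on that range. But generic points lie in it, and so does the whole fibre over a
generic point, which has at least two elements. -/

theorem MvPolynomial.exists_eval_ne_zero {k : ℕ} {Q : MvPolynomial (Fin k) ℂ} (hQ : Q ≠ 0) :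
    ∃ p : Fin k → ℂ, MvPolynomial.eval p Q ≠ 0 := by
  by_contra! hc
  exact hQ (MvPolynomial.funext fun x => by rw [hc x, map_zero])

theorem eval_aeval_eq_eval_polyMap {k : ℕ} (P : Fin k → MvPolynomial (Fin k) ℂ)
    (R : MvPolynomial (Fin k) ℂ) (z : Fin k → ℂ) :
    MvPolynomial.eval z (MvPolynomial.aeval P R) = MvPolynomial.eval (polyMap P z) R := by
  induction R using MvPolynomial.induction_on with
  | C a => simp
  | add p q hp hq => simp only [map_add, hp, hq]
  | mul_X p i hp =>
    simp only [map_mul, hp, MvPolynomial.aeval_X, MvPolynomial.eval_X, polyMap]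

/-- The coordinates of a polynomial mapping with generically non-empty fibres are
algebraically independent. -/
theorem algebraicIndependent_of_generic_mem_range {k : ℕ} {P : Fin k → MvPolynomial (Fin k) ℂ}
    {Q : MvPolynomial (Fin k) ℂ} (hQ : Q ≠ 0)
    (h : ∀ p, MvPolynomial.eval p Q ≠ 0 → p ∈ Set.range (polyMap P)) :
    AlgebraicIndependent ℂ P := by
  rw [algebraicIndependent_iff]
  intro R hR
  by_contra hR0
  obtain ⟨p, hp⟩ := MvPolynomial.exists_eval_ne_zero (mul_ne_zero hR0 hQ)
  rw [map_mul] at hp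
  obtain ⟨z, rfl⟩ := h p (right_ne_zero_of_mul hp)
  apply left_ne_zero_of_mul hp
  rw [← eval_aeval_eq_eval_polyMap, hR, map_zero]

/-- If the coordinates of a polynomial mapping are algebraically independent, then the image of
a proper algebraic subset is contained in a proper algebraic subset. -/
theorem AlgebraicIndependent.exists_eval_polyMap_ne_zero_imp {k : ℕ}
    {P : Fin k → MvPolynomial (Fin k) ℂ} (hP : AlgebraicIndependent ℂ P)
    {S : MvPolynomial (Fin k) ℂ} (hS : S ≠ 0) :
    ∃ R : MvPolynomial (Fin k) ℂ, R ≠ 0 ∧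
      ∀ z, MvPolynomial.eval (polyMap P z) R ≠ 0 → MvPolynomial.eval z S ≠ 0 := by
  -- The transcendence degree is `k`, so `S` is algebraic over `ℂ[P]` and divides some non-zero
  -- `R(P)`.
  have hbasis : IsTranscendenceBasis ℂ P :=
    hP.isTranscendenceBasis_of_trdeg_le_of_finite (by simp [MvPolynomial.trdeg_of_isDomain])
  obtain ⟨⟨r, hr⟩, hr0, hdvd⟩ := (hbasis.isAlgebraic.isAlgebraic S).exists_nonzero_dvd
    (mem_nonZeroDivisors_of_ne_zero hS)
  rw [Algebra.adjoin_range_eq_range_aeval] at hr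
  obtain ⟨R, rfl⟩ := hr
  obtain ⟨T, hT⟩ := hdvd
  refine ⟨R, fun h => hr0 (Subtype.ext (by simp [h])), fun z hz hSz => hz ?_⟩
  rw [← eval_aeval_eq_eval_polyMap]
  exact (congrArg (MvPolynomial.eval z) hT).trans (by rw [map_mul, hSz, zero_mul])

/-- The iterates of a polynomial mapping with generically non-empty fibres have generically
non-empty fibres. -/
theorem exists_generic_mem_range_iterate {k : ℕ} {P : Fin k → MvPolynomial (Fin k) ℂ}
    {Q : MvPolynomial (Fin k) ℂ} (hQ : Q ≠ 0)
    (h : ∀ p, MvPolynomial.eval p Q ≠ 0 → p ∈ Set.range (polyMap P)) (m : ℕ) :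
    ∃ S : MvPolynomial (Fin k) ℂ, S ≠ 0 ∧
      ∀ p, MvPolynomial.eval p S ≠ 0 → p ∈ Set.range (polyMap P)^[m] := by
  induction m with
  | zero => exact ⟨1, one_ne_zero, fun p _ => ⟨p, rfl⟩⟩
  | succ m ih =>
    obtain ⟨S, hS, hSm⟩ := ih
    obtain ⟨R, hR, hRS⟩ :=
      (algebraicIndependent_of_generic_mem_range hQ h).exists_eval_polyMap_ne_zero_imp hS
    -- `Q` gives a preimage of `p`; `R` keeps it off the zeros of `S`.
    refine ⟨R * Q, mul_ne_zero hR hQ, fun p hp => ?_⟩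
    rw [map_mul] at hp
    obtain ⟨q, rfl⟩ := h p (right_ne_zero_of_mul hp)
    obtain ⟨z, rfl⟩ := hSm q (hRS q (left_ne_zero_of_mul hp))
    exact ⟨z, Function.iterate_succ_apply' _ _ _⟩

/-- If `f` has a global time average, then `f` is injective on the range of some iterate. -/
theorem HasGlobalTimeAverage.exists_injOn_range_iterate {k : ℕ}
    {f : (Fin k → ℂ) → (Fin k → ℂ)} (h : HasGlobalTimeAverage f) :
    ∃ m : ℕ, Set.InjOn f (Set.range f^[m]) := by
  classical
  obtain ⟨c, a, ha, hconv⟩ := h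
  refine ⟨Nat.find ha, ?_⟩
  rintro _ ⟨z, rfl⟩ _ ⟨w, rfl⟩ hzw
  have hlim (x : Fin k → ℂ) : Filter.Tendsto
      (fun N : ℕ => ∑ n ∈ Finset.range (N + 1), a n • f^[n] x) Filter.atTop (nhds c) :=
    (hconv {x} isCompact_singleton).tendsto_at rfl
  have hterm (n : ℕ) (hn : n ≠ Nat.find ha) : a n • f^[n] z - a n • f^[n] w = 0 := by
    rcases lt_or_gt_of_ne hn with hlt | hgt
    · simp [not_not.mp (Nat.find_min ha hlt)]
    · obtain ⟨j, rfl⟩ := Nat.exists_eq_add_of_lt hgt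
      -- Later iterates factor through `f ∘ f^[m]`, which agrees at `z` and `w`.
      have hsplit (x : Fin k → ℂ) :
          f^[Nat.find ha + j + 1] x = f^[j] (f (f^[Nat.find ha] x)) := by
        rw [← Function.iterate_succ_apply, ← Function.iterate_add_apply]
        exact congrArg (fun n => f^[n] x) (by omega)
      rw [hsplit, hsplit, hzw, sub_self]
  have hdiff := (hlim z).sub (hlim w)
  rw [sub_self] at hdiff
  have hconst : Filter.Tendsto (fun N : ℕ => ∑ n ∈ Finset.range (N + 1), a n • f^[n] z -
      ∑ n ∈ Finset.range (N + 1), a n • f^[n] w) Filter.atTop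
      (nhds (a (Nat.find ha) • (f^[Nat.find ha] z - f^[Nat.find ha] w))) := by
    refine tendsto_const_nhds.congr' ?_
    filter_upwards [Filter.eventually_ge_atTop (Nat.find ha)] with N hN
    rw [← Finset.sum_sub_distrib, Finset.sum_eq_single_of_mem (Nat.find ha)
      (Finset.mem_range.mpr (Nat.lt_succ_of_le hN)) (fun n _ hn => hterm n hn), smul_sub]
  exact sub_eq_zero.mp ((smul_eq_zero.mp (tendsto_nhds_unique hconst hdiff)).resolve_left
    (Nat.find_spec ha))

/-- A polynomial mapping of topological degree at least two has no global time average. -/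
theorem HasTopologicalDegree.not_hasGlobalTimeAverage {k m : ℕ}
    {P : Fin k → MvPolynomial (Fin k) ℂ} (htop : HasTopologicalDegree (polyMap P) m)
    (hm : 2 ≤ m) : ¬ HasGlobalTimeAverage (polyMap P) := by
  intro havg
  obtain ⟨Q, hQ, hfib⟩ := htop
  obtain ⟨n, hinj⟩ := havg.exists_injOn_range_iterate
  have hfib' (p) (hp : MvPolynomial.eval p Q ≠ 0) : 1 < (polyMap P ⁻¹' {p}).encard := by
    rw [hfib p hp]
    exact_mod_cast hm
  have hrange (p) (hp : MvPolynomial.eval p Q ≠ 0) : p ∈ Set.range (polyMap P) :=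
    Set.encard_pos.mp (zero_lt_one.trans (hfib' p hp))
  obtain ⟨S, hS, hSn⟩ := exists_generic_mem_range_iterate hQ hrange n
  obtain ⟨R, hR, hRS⟩ :=
    (algebraicIndependent_of_generic_mem_range hQ hrange).exists_eval_polyMap_ne_zero_imp hS
  obtain ⟨p, hp⟩ := MvPolynomial.exists_eval_ne_zero (mul_ne_zero hR hQ)
  rw [map_mul] at hp
  -- `R` controls every preimage of `p` at once.
  have hmem (q) (hq : polyMap P q = p) : q ∈ Set.range (polyMap P)^[n] :=
    hSn q (hRS q (hq ▸ left_ne_zero_of_mul hp))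
  obtain ⟨z, w, hz, hw, hne⟩ := Set.one_lt_encard_iff.mp (hfib' p (right_ne_zero_of_mul hp))
  exact hne (hinj (hmem z hz) (hmem w hw) (Eq.trans hz (Eq.symm hw)))

theorem mainTheorem9 (k d : ℕ) (P : Fin k → MvPolynomial (Fin k) ℂ) (hd : 2 ≤ d)
    (halg : algebraicDegree P = d) (htop : HasTopologicalDegree (polyMap P) (d ^ k)) :
    ¬ HasGlobalTimeAverage (polyMap P) := by
  -- For `k = 0` the supremum is empty, so the degree is 0.
  have hk : k ≠ 0 := by
    rintro rfl
    simp [algebraicDegree] at halg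
    omega
  exact htop.not_hasGlobalTimeAverage (hd.trans (Nat.le_self_pow hk d))
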